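/- Let $F\subseteq K\subseteq L$ be fields and let $\sigma:L\to L$ be an automorphism such that the triple $(F,K,L)$ is $\sigma$-admissible: $\sigma$ restricts to automorphisms of $F$ and of $K$; $F=F^\sigma=K^\sigma=L^\sigma$ (fixed elements of $\sigma$); and $L$ is a (not necessarily algebraic) separable extension of $K$, i.e. $\overline K\otimes_K L$ is reduced. Let $\Phi\in\mathrm{GL}_r(K)$ and $\Psi\in\mathrm{GL}_r(L)$ satisfy $\sigma(\Psi)=\Phi\Psi$. Let $X=(X_{ij})$ be an $r\times r$ matrix of independent variables. Let $\Sigma=K[\Psi,1/\det\Psi]\subseteq L$ be the image of the $K$-algebra map $K[X,1/\det X]\to L$, $X_{ij}\mapsto\Psi_{ij}$, let $\Lambda$ be the fraction field of $\Sigma$, and let $Z=\operatorname{Spec}\Sigma$, a closed $K$-subscheme of $\mathrm{GL}_{r/K}$. Let $\Psi_1,\Psi_2\in\mathrm{GL}_r(L\otimes_K L)$ be the matrices with entries $\Psi_{ij}\otimes 1$ and $1\otimes\Psi_{ij}$, let $\Delta$ be the image of the $F$-algebra map $F[X,1/\det X]\to L\otimes_K L$, $X_{ij}\mapsto(\Psi_1^{-1}\Psi_2)_{ij}$,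 and let $\Gamma=\operatorname{Spec}\Delta$, a closed $F$-subscheme of $\mathrm{GL}_{r/F}$. Suppose that $K$ is algebraically closed in $\Lambda$. Then (a) the $K$-scheme $Z$ is absolutely irreducible and is smooth over $\overline K$ (that is, $Z_{\overline K}$ is smooth over $\overline K$); (b) the $F$-scheme $\Gamma$ is absolutely irreducible and is smooth over $\overline F$ (that is, $\Gamma_{\overline F}$ is smooth over $\overline F$); (c) the dimension of $\Gamma$ over $F$ is equal to the transcendence degree of $\Lambda$ over $K$. Here a scheme over a field $k$ is called absolutely irreducible if its base change to every extension field of $k$ is irreducible. -/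

import Mathlib

open CategoryTheory Limits AlgebraicGeometry
open scoped TensorProduct MatrixGroups

universe u

namespace SigmaSemilinear

/-- For fields `F ⊆ K ⊆ L` and an automorphism `σ` of `L`: the triple `(F, K, L)` is
`σ`-admissible. Here `L / K` need not be algebraic, so separability means that `L ⊗ K̄` is
reduced. As `F ⊆ K ⊆ L`, the field `fixed` amounts to `F = F^σ = K^σ = L^σ`. -/
structure IsAdmissible (F K L : Type u) [Field F] [Field K] [Field L]
    [Algebra F K] [Algebra K L] [Algebra F L] [IsScalarTower F K L] (σ : L ≃+* L) : Prop where
  restricts_F : (algebraMap F L).fieldRange.map (σ : L →+* L) = (algebraMap F L).fieldRange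
  restricts_K : (algebraMap K L).fieldRange.map (σ : L →+* L) = (algebraMap K L).fieldRange
  fixed : ∀ x : L, σ x = x ↔ x ∈ (algebraMap F L).fieldRange
  separable : Algebra.IsGeometricallyReduced K L

noncomputable section

/-- The coordinate ring `R[X, 1 / det X]` of the `R`-group scheme `GL_r`, with `X` an `r × r`
matrix of independent variables. -/
abbrev CoordRing (R : Type u) [CommRing R] (r : ℕ) : Type u :=
  Localization.Away (Matrix.mvPolynomialX (Fin r) (Fin r) R).det

theorem isUnit_aeval {R S : Type u} [CommRing R] [CommRing S] [Algebra R S] {r : ℕ}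
    (M : GL (Fin r) S)
    (y : Submonoid.powers (Matrix.mvPolynomialX (Fin r) (Fin r) R).det) :
    IsUnit (MvPolynomial.aeval (R := R) (fun p : Fin r × Fin r => M.val p.1 p.2)
      (y : MvPolynomial (Fin r × Fin r) R)) := by
  obtain ⟨_, n, rfl⟩ := y
  have h : MvPolynomial.aeval (R := R) (fun p : Fin r × Fin r => M.val p.1 p.2)
      (Matrix.mvPolynomialX (Fin r) (Fin r) R).det = M.val.det := by
    rw [AlgHom.map_det, Matrix.mvPolynomialX_mapMatrix_aeval]
  simp only [map_pow, h]
  exact ((Matrix.isUnit_iff_isUnit_det _).1 M.isUnit).pow n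

/-- Evaluation `R[X, 1 / det X] → S`, `X ↦ M`, at an `S`-valued point `M` of `GL_r`. -/
def evalGL (R : Type u) {S : Type u} [CommRing R] [CommRing S] [Algebra R S] {r : ℕ}
    (M : GL (Fin r) S) : CoordRing R r →ₐ[R] S :=
  IsLocalization.liftAlgHom
    (M := Submonoid.powers (Matrix.mvPolynomialX (Fin r) (Fin r) R).det)
    (f := MvPolynomial.aeval (fun p : Fin r × Fin r => M.val p.1 p.2)) (isUnit_aeval M)

section Torsor

variable (K : Type u) {L : Type u} [Field K] [Field L] [Algebra K L] {r : ℕ} (Ψ : GL (Fin r) L)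

/-- The `K`-algebra `K[Ψ, 1 / det Ψ] ⊆ L`, the image of `ν : K[X, 1 / det X] → L`, `X ↦ Ψ`. -/
abbrev solutionAlgebra : Subalgebra K L := (evalGL K Ψ).range

/-- The fraction field `Λ` of `K[Ψ, 1 / det Ψ]`. -/
abbrev solutionField : Type u := FractionRing (solutionAlgebra K Ψ)

/-- The scheme `Z = Spec K[Ψ, 1 / det Ψ]`. -/
abbrev Z : Scheme.{u} := Spec (CommRingCat.of (solutionAlgebra K Ψ))

/-- The structure morphism `Z ⟶ Spec K`. -/
abbrev Z.structureMap : Z K Ψ ⟶ Spec (CommRingCat.of K) :=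
  Spec.map (CommRingCat.ofHom (algebraMap K (solutionAlgebra K Ψ)))

end Torsor

section Group

variable (F K : Type u) {L : Type u} [Field F] [Field K] [Field L]
  [Algebra F K] [Algebra K L] [Algebra F L] [IsScalarTower F K L] {r : ℕ} (Ψ : GL (Fin r) L)

/-- The matrix `Ψ₁⁻¹ Ψ₂` in `GL_r (L ⊗[K] L)`, where `Ψ₁` has the entries `Ψᵢⱼ ⊗ 1` and `Ψ₂` has
the entries `1 ⊗ Ψᵢⱼ`. -/
def psiTilde : GL (Fin r) (L ⊗[K] L) :=
  (Matrix.GeneralLinearGroup.map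
    (Algebra.TensorProduct.includeLeft : L →ₐ[K] L ⊗[K] L).toRingHom Ψ)⁻¹ *
  Matrix.GeneralLinearGroup.map
    (Algebra.TensorProduct.includeRight : L →ₐ[K] L ⊗[K] L).toRingHom Ψ

/-- The `F`-algebra `Δ ⊆ L ⊗[K] L`, the image of `μ : F[X, 1 / det X] → L ⊗[K] L`,
`X ↦ Ψ₁⁻¹ Ψ₂`. -/
abbrev groupAlgebra : Subalgebra F (L ⊗[K] L) := (evalGL F (psiTilde K Ψ)).range

/-- The scheme `Γ = Spec Δ`. -/
abbrev Γ : Scheme.{u} := Spec (CommRingCat.of (groupAlgebra F K Ψ))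

/-- The structure morphism `Γ ⟶ Spec F`. -/
abbrev Γ.structureMap : Γ F K Ψ ⟶ Spec (CommRingCat.of F) :=
  Spec.map (CommRingCat.ofHom (algebraMap F (groupAlgebra F K Ψ)))

end Group

/-- For a scheme `X` over a field `k`, the base change `X ×ₖ Spec k̄ ⟶ Spec k̄` to an algebraic
closure `k̄` of `k`. -/
abbrev baseChangeClosure {k : Type u} [Field k] {X : Scheme.{u}}
    (f : X ⟶ Spec (CommRingCat.of k)) :
    pullback f (Spec.map (CommRingCat.ofHom (algebraMap k (AlgebraicClosure k)))) ⟶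
      Spec (CommRingCat.of (AlgebraicClosure k)) :=
  pullback.snd f (Spec.map (CommRingCat.ofHom (algebraMap k (AlgebraicClosure k))))

end

end SigmaSemilinear

/-!
`Z` is a torsor under `Γ`: writing `Σ = K[Ψ, 1 / det Ψ]` and `Δ` for the algebra of `Γ`, the
inclusions into `L ⊗[K] L` induce an isomorphism `Σ ⊗[F] Δ ≃ Σ ⊗[K] Σ` (`exists_torsor_equiv`).
Its image is clear from `Ψ₂ = Ψ₁ (Ψ₁⁻¹ Ψ₂)`. Injectivity holds because `Δ` consists of invariants
of `σ ⊗ σ`, and by Artin's argument invariants that are linearly independent over `F = L^σ` are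
linearly independent over `L` (`linearIndependent_of_forall_fixed`). Multiplication `L ⊗[K] L → L`
maps `Δ` into `F` and provides a counit. Hence every point `z` of `Z` over some base gives an
isomorphism `w ↦ z⁻¹ w` from `Z` to `Γ` over that base which takes `z` to the unit element
(`exists_baseChange_groupAlgebra_equiv`). The comultiplication of `Δ` is not needed.

As `L / K` is separable and `K` is algebraically closed in `Λ ⊆ L`, the extension `Λ / K` is
regular, so `Σ` remains a domain over every extension of `K` (`isDomain_tensorProduct_of_algHom`):
over a separable closure by Artin's argument for a group of automorphisms, over an algebraic
closure because that is purely inseparable over the separable one and the tensor product is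
reduced, and then over every field by specialisation to rational points. Over a field that
contains `L`, the point `Ψ` identifies `Γ` with `Z`, so `Δ` remains a domain over every extension
of `F` too.

Over an algebraic closure of `K`, the isomorphisms with `Γ` given by any two points of `Z` combine
into an automorphism of `Z` that takes one point to the other. The smooth locus of the reduced
scheme `Z` is dense, so by homogeneity it is everything (`smooth_of_homogeneous`). Smoothness of
`Z` over `K`, and of `Γ`, which becomes isomorphic to `Z`, over `F`, then follows by faithfully
flat descent. By Noether normalisation the dimension is invariant under base field extension and
equals the transcendence degree, so `dim Γ = dim Z = trdeg (Λ / K)`.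
-/

universe v w w₂

namespace SigmaSemilinear

/-! ### Vectors fixed by semilinear maps -/

/-- Artin's argument: if the maps `t i` of an `E`-vector space `V` are semilinear over endomorphisms
`s i` of `E` whose common fixed elements lie in `F`, then vectors fixed by all `t i` that are
linearly independent over `F` are linearly independent over `E`. -/
theorem linearIndependent_of_forall_fixed {F E V ι κ : Type*} [Field F] [Field E] [AddCommGroup V]
    [Algebra F E] [Module E V] [Module F V] [IsScalarTower F E V]
    (s : ι → E →+* E) (t : ι → V →+ V) (hst : ∀ i a x, t i (a • x) = s i a • t i x)
    (hs : ∀ a, (∀ i, s i a = a) → a ∈ (algebraMap F E).range)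
    {v : κ → V} (hv : ∀ i k, t i (v k) = v k) (hF : LinearIndependent F v) :
    LinearIndependent E v := by
  classical
  rw [linearIndependent_iff]
  by_contra! h
  obtain ⟨c, ⟨hc, hc0⟩, hmin⟩ := WellFounded.has_min
    (InvImage.wf (fun c : κ →₀ E => c.support.card) wellFounded_lt)
    {c | Finsupp.linearCombination E v c = 0 ∧ c ≠ 0} (by obtain ⟨c, h⟩ := h; exact ⟨c, h⟩)
  obtain ⟨k, hk⟩ := Finsupp.ne_iff.1 hc0
  rw [Finsupp.zero_apply] at hk
  have hsupp : ∀ d : κ →₀ E, Finsupp.linearCombination E v d = 0 → d.support ⊆ c.support →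
      d k = 0 → d = 0 := by
    intro d hd hdc hdk
    by_contra hd0
    refine hmin d ⟨hd, hd0⟩ (Finset.card_lt_card ⟨hdc, fun h => ?_⟩)
    simpa [hdk] using h (Finsupp.mem_support_iff.2 hk)
  -- A relation `c` of minimal support, normalised so that its coefficient at `k` is `1`.
  let c' : κ →₀ E := (c k)⁻¹ • c
  have hc' : Finsupp.linearCombination E v c' = 0 := by simp [c', hc]
  have hc'k : c' k = 1 := by simp [c', hk]
  have hc's : c'.support ⊆ c.support := Finsupp.support_smul
  have hfix : ∀ i j, s i (c' j) = c' j := by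
    intro i j
    -- Applying `s i` to the coefficients gives a relation; the difference vanishes at `k`.
    have h0 : Finsupp.mapRange (s i) (map_zero _) c' - c' = 0 := by
      refine hsupp _ ?_ ?_ ?_
      · have h1 := congrArg (t i) hc'
        rw [Finsupp.linearCombination_apply, Finsupp.sum, map_sum, map_zero] at h1
        simp only [hst, hv] at h1
        rw [map_sub, hc', sub_zero, Finsupp.linearCombination_apply,
          Finsupp.sum_mapRange_index (by simp), Finsupp.sum, h1]
      · intro j hj
        refine hc's (Finsupp.mem_support_iff.2 fun hj0 => ?_)
        simp [hj0] at hj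
      · simp [hc'k]
    simpa [sub_eq_zero] using DFunLike.congr_fun h0 j
  choose d hd using fun j => hs (c' j) (hfix · j)
  let d' : κ →₀ F := Finsupp.onFinset c'.support d fun j hj => by
    rw [Finsupp.mem_support_iff, ← hd]
    simpa using hj
  have hd' : Finsupp.linearCombination F v d' = 0 := by
    rw [← hc', Finsupp.linearCombination_apply, Finsupp.linearCombination_apply,
      Finsupp.onFinset_sum _ (by simp), Finsupp.sum]
    refine Finset.sum_congr rfl fun j _ => ?_
    rw [← hd, algebraMap_smul]
  have := DFunLike.congr_fun (linearIndependent_iff.1 hF d' hd') k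
  have h1 : c' k = 0 := by
    rw [← hd]
    simpa [d'] using this
  exact one_ne_zero (hc'k.symm.trans h1)

/-- In the situation of Artin's argument, an `F`-subspace `D` of fixed vectors satisfies
`E ⊗[F] D ↪ V`. -/
theorem liftBaseChange_injective_of_forall_fixed {F E V D ι : Type*} [Field F] [Field E]
    [AddCommGroup V] [Algebra F E] [Module E V] [Module F V] [IsScalarTower F E V]
    [AddCommGroup D] [Module F D]
    (s : ι → E →+* E) (t : ι → V →+ V) (hst : ∀ i a x, t i (a • x) = s i a • t i x)
    (hs : ∀ a, (∀ i, s i a = a) → a ∈ (algebraMap F E).range)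
    (j : D →ₗ[F] V) (hj : Function.Injective j) (hfix : ∀ i x, t i (j x) = j x) :
    Function.Injective (LinearMap.liftBaseChange E j) := by
  let b := Module.Free.chooseBasis F D
  have hli : LinearIndependent E (j ∘ b) :=
    linearIndependent_of_forall_fixed s t hst hs (fun i k => hfix i _)
      (b.linearIndependent.map' j (LinearMap.ker_eq_bot.2 hj))
  have : LinearMap.liftBaseChange E j =
      Finsupp.linearCombination E (j ∘ b) ∘ₗ (b.baseChange E).repr.toLinearMap := by
    refine (b.baseChange E).ext fun k => ?_
    rw [LinearMap.comp_apply, LinearEquiv.coe_coe, Module.Basis.repr_self]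
    simp
  rw [this]
  exact (linearIndependent_iff_injective_finsuppLinearCombination.1 hli).comp
    (b.baseChange E).repr.injective

/-! ### Regular field extensions -/

/-- A nonzero element of a finitely generated domain over an algebraically closed field is nonzero
at some rational point. -/
theorem exists_algHom_apply_ne_zero {k A : Type*} [Field k] [IsAlgClosed k] [CommRing A]
    [IsDomain A] [Algebra k A] [Algebra.FiniteType k A] {a : A} (ha : a ≠ 0) :
    ∃ φ : A →ₐ[k] k, φ a ≠ 0 := by
  have : Nontrivial (Localization.Away a) :=
    (IsLocalization.isDomain_localization
      (powers_le_nonZeroDivisors_of_noZeroDivisors ha)).toNontrivial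
  obtain ⟨m, hm⟩ := Ideal.exists_maximal (Localization.Away a)
  let := Ideal.Quotient.field m
  have : Algebra.FiniteType A (Localization.Away a) :=
    have := IsLocalization.Away.finitePresentation a (S := Localization.Away a); inferInstance
  have : Algebra.FiniteType k (Localization.Away a) := .trans (S := A) inferInstance inferInstance
  have : Module.Finite k (Localization.Away a ⧸ m) := finite_of_finite_type_of_isJacobsonRing _ _
  have hbij :=
    IsAlgClosed.algebraMap_bijective_of_isIntegral (k := k) (K := Localization.Away a ⧸ m)
  let e : k ≃ₐ[k] (Localization.Away a ⧸ m) := AlgEquiv.ofBijective (Algebra.ofId _ _) hbij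
  refine ⟨e.symm.toAlgHom.comp ((Ideal.Quotient.mkₐ k m).comp
    (IsScalarTower.toAlgHom k A (Localization.Away a))), ?_⟩
  have : IsUnit (algebraMap A (Localization.Away a) a) :=
    IsLocalization.map_units _ (⟨a, 1, pow_one a⟩ : Submonoid.powers a)
  exact ((this.map (Ideal.Quotient.mkₐ k m)).map e.symm).ne_zero

/-- If `x * y = 0` in `A ⊗ B`, take nonzero coefficients of `x` and `y` with respect to a basis of
`B`, and specialise at a rational point of `A` where both are nonzero: the images of `x` and `y` in
the domain `B` are nonzero with product zero. -/
theorem isDomain_tensorProduct_of_isAlgClosed (k A B : Type*) [Field k] [IsAlgClosed k]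
    [CommRing A] [IsDomain A] [Algebra k A] [Algebra.FiniteType k A]
    [CommRing B] [IsDomain B] [Algebra k B] : IsDomain (A ⊗[k] B) := by
  let b := Module.Free.chooseBasis k B
  let ψ (φ : A →ₐ[k] k) : A ⊗[k] B →ₐ[k] B :=
    Algebra.TensorProduct.productMap ((Algebra.ofId k B).comp φ) (AlgHom.id k B)
  have hψ (φ : A →ₐ[k] k) (x : A ⊗[k] B) (i) :
      b.repr (ψ φ x) i = φ ((b.baseChange A).repr x i) := by
    induction x with
    | zero => simp
    | add x y hx hy => simp [hx, hy]
    | tmul a y =>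
      simp only [ψ, Algebra.TensorProduct.productMap_apply_tmul, AlgHom.comp_apply,
        Algebra.ofId_apply, AlgHom.id_apply, ← Algebra.smul_def, map_smul, Finsupp.smul_apply,
        smul_eq_mul, Module.Basis.baseChange_repr_tmul]
      exact mul_comm _ _
  have : NoZeroDivisors (A ⊗[k] B) := by
    refine ⟨fun {x y} hxy => ?_⟩
    by_contra! h
    have hx : ∃ i, (b.baseChange A).repr x i ≠ 0 := by
      by_contra! h0
      exact h.1 ((b.baseChange A).repr.map_eq_zero_iff.1 (Finsupp.ext h0))
    have hy : ∃ i, (b.baseChange A).repr y i ≠ 0 := by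
      by_contra! h0
      exact h.2 ((b.baseChange A).repr.map_eq_zero_iff.1 (Finsupp.ext h0))
    obtain ⟨i, hi⟩ := hx
    obtain ⟨j, hj⟩ := hy
    obtain ⟨φ, hφ⟩ := exists_algHom_apply_ne_zero (k := k) (mul_ne_zero hi hj)
    rw [map_mul, ← hψ, ← hψ] at hφ
    have h0 : ψ φ x * ψ φ y = 0 := by rw [← map_mul, hxy, map_zero]
    rcases mul_eq_zero.1 h0 with h0 | h0 <;> simp [h0] at hφ
  have : Nontrivial (A ⊗[k] B) :=
    (Algebra.TensorProduct.includeLeft_injective (R := k) (S := k) (A := A) (B := B)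
      (algebraMap k B).injective).nontrivial
  exact NoZeroDivisors.to_isDomain _

theorem mem_range_algebraMap_of_isSeparable_of_fixed {K Ω : Type*} [Field K] [Field Ω]
    [Algebra K Ω] [IsAlgClosure K Ω] {x : Ω} (hx : IsSeparable K x) (h : ∀ g : Ω ≃ₐ[K] Ω, g x = x) :
    x ∈ (algebraMap K Ω).range := by
  have := IsAlgClosure.isAlgClosed K (K := Ω)
  have : Normal K Ω := IsAlgClosure.normal K Ω
  by_contra hx'
  obtain ⟨y, hne, hy⟩ := (notMem_iff_exists_ne_and_isConjRoot hx
    (IsAlgClosed.splits _)).1 fun h0 => hx' (Algebra.mem_bot.1 h0)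
  obtain ⟨g, hg⟩ := hy.symm.exists_algEquiv
  exact hne ((h g).symm.trans hg)

/-- Artin's argument for the group of automorphisms of `Ω` over `E` acting on the separable closure
of `K` in `Ω`: a fixed element lies in `E` and is algebraic over `K`, hence lies in `K`. So the
separable closure and `E` are linearly disjoint inside `Ω`. -/
theorem isDomain_separableClosure_tensorProduct {K E : Type*} [Field K] [Field E] [Algebra K E]
    (hcl : algebraicClosure K E = ⊥) (Ω : Type*) [Field Ω] [Algebra K Ω] [Algebra E Ω]
    [IsScalarTower K E Ω] [IsAlgClosure E Ω] :
    IsDomain (separableClosure K Ω ⊗[K] E) := by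
  let f : separableClosure K Ω ⊗[K] E →ₐ[K] Ω :=
    Algebra.TensorProduct.productMap (separableClosure K Ω).val (IsScalarTower.toAlgHom K E Ω)
  have hinj := liftBaseChange_injective_of_forall_fixed (F := K) (E := separableClosure K Ω)
    (V := Ω) (ι := Ω ≃ₐ[E] Ω)
    (fun g => (g : Ω →+* Ω).restrict (separableClosure K Ω) (separableClosure K Ω) fun x hx =>
      (map_mem_separableClosure_iff ((g.restrictScalars K : Ω ≃ₐ[K] Ω) : Ω →ₐ[K] Ω)).2 hx)
    (fun g => (g : Ω →+* Ω).toAddMonoidHom) (fun g a x => map_mul g _ _) (by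
      intro a ha
      have h1 : (a : Ω) ∈ (algebraMap E Ω).range :=
        mem_range_algebraMap_of_isSeparable_of_fixed
          (IsSeparable.tower_top E (mem_separableClosure_iff.1 a.2))
          fun g => congrArg Subtype.val (ha g)
      obtain ⟨e, he⟩ := h1
      have h2 : e ∈ algebraicClosure K E := by
        rw [mem_algebraicClosure_iff, ← isAlgebraic_algebraMap_iff (algebraMap E Ω).injective, he]
        exact (mem_separableClosure_iff.1 a.2).isIntegral.isAlgebraic
      rw [hcl, IntermediateField.mem_bot] at h2
      obtain ⟨c, rfl⟩ := h2
      exact ⟨c, Subtype.ext (by rw [← he, ← IsScalarTower.algebraMap_apply]; rfl)⟩)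
    (IsScalarTower.toAlgHom K E Ω).toLinearMap (algebraMap E Ω).injective
    (fun g x => g.commutes x)
  refine Function.Injective.isDomain f.toRingHom ?_
  convert hinj using 1
  ext x
  induction x with
  | zero => simp
  | add x y hx hy => rw [map_add, map_add, hx, hy]
  | tmul a y => simp [f, Algebra.smul_def]

/-- Every element of `R ⊗[k] K` has a power in the domain `R`, so a zero divisor is nilpotent. -/
theorem isDomain_of_isPurelyInseparable {k K R : Type*} [Field k] [Field K] [Algebra k K]
    [IsPurelyInseparable k K] [CommRing R] [Algebra k R] [IsDomain R] [IsReduced (R ⊗[k] K)] :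
    IsDomain (R ⊗[k] K) := by
  have hinj : Function.Injective (algebraMap R (R ⊗[k] K)) :=
    Algebra.TensorProduct.includeLeft_injective (R := k) (S := k) (algebraMap k K).injective
  have := hinj.nontrivial
  have : NoZeroDivisors (R ⊗[k] K) := by
    refine ⟨fun {x y} hxy => ?_⟩
    have hq : ringExpChar k ≠ 0 := (expChar_pos k _).ne'
    obtain ⟨n, r, hr⟩ :=
      IsPurelyInseparable.exists_pow_pow_mem_range_tensorProduct_of_expChar (ringExpChar k) x
    obtain ⟨m, s, hs⟩ :=
      IsPurelyInseparable.exists_pow_pow_mem_range_tensorProduct_of_expChar (ringExpChar k) y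
    have hrs : r * s = 0 := hinj <| by
      rw [map_mul, hr, hs, map_zero]
      refine zero_dvd_iff.1 ?_
      rw [← hxy]
      exact mul_dvd_mul (dvd_pow_self _ (pow_ne_zero _ hq)) (dvd_pow_self _ (pow_ne_zero _ hq))
    rcases mul_eq_zero.1 hrs with rfl | rfl
    · exact .inl (pow_eq_zero_iff (pow_ne_zero n hq) |>.1 (by rw [← hr, map_zero]))
    · exact .inr (pow_eq_zero_iff (pow_ne_zero m hq) |>.1 (by rw [← hs, map_zero]))
  exact NoZeroDivisors.to_isDomain _

theorem isDomain_tensorProduct_of_isPurelyInseparable (K S C E : Type*) [Field K] [Field S]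
    [Field C] [CommRing E] [Algebra K S] [Algebra S C] [Algebra K C] [IsScalarTower K S C]
    [Algebra K E] [IsPurelyInseparable S C] [IsDomain (S ⊗[K] E)] [_root_.IsReduced (C ⊗[K] E)] :
    IsDomain (C ⊗[K] E) := by
  let e : (S ⊗[K] E) ⊗[S] C ≃+* C ⊗[K] E :=
    (Algebra.TensorProduct.comm S (S ⊗[K] E) C).toRingEquiv.trans
      (Algebra.TensorProduct.cancelBaseChange K S S C E).toRingEquiv
  have : _root_.IsReduced ((S ⊗[K] E) ⊗[S] C) := isReduced_of_injective e e.injective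
  have : IsDomain ((S ⊗[K] E) ⊗[S] C) := isDomain_of_isPurelyInseparable
  exact e.symm.toMulEquiv.isDomain

theorem isDomain_algebraicClosure_tensorProduct {K E : Type*} [Field K] [Field E] [Algebra K E]
    [Algebra.IsGeometricallyReduced K E] (hcl : algebraicClosure K E = ⊥) :
    IsDomain (AlgebraicClosure K ⊗[K] E) := by
  have := isDomain_separableClosure_tensorProduct hcl (AlgebraicClosure E)
  let e : separableClosure K (AlgebraicClosure K) ≃ₐ[K] separableClosure K (AlgebraicClosure E) :=
    IsSepClosure.equiv K _ _
  have : IsDomain (separableClosure K (AlgebraicClosure K) ⊗[K] E) :=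
    (Algebra.TensorProduct.congr e (AlgEquiv.refl (A₁ := E))).toMulEquiv.isDomain
  have := (Algebra.isGeometricallyReduced_field_iff K E).1 inferInstance
  exact isDomain_tensorProduct_of_isPurelyInseparable K
    (separableClosure K (AlgebraicClosure K)) (AlgebraicClosure K) E

/-- A finitely generated subalgebra of a regular field extension of `K` stays a domain after every
extension of the base field. -/
theorem isDomain_tensorProduct_of_algHom {K A E : Type*} [Field K] [CommRing A] [Algebra K A]
    [Algebra.FiniteType K A] [Field E] [Algebra K E]
    [Algebra.IsGeometricallyReduced K E] (hcl : algebraicClosure K E = ⊥)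
    (i : A →ₐ[K] E) (hi : Function.Injective i) (K' : Type*) [Field K'] [Algebra K K'] :
    IsDomain (K' ⊗[K] A) := by
  have := isDomain_algebraicClosure_tensorProduct hcl
  have hA : IsDomain (AlgebraicClosure K ⊗[K] A) :=
    Function.Injective.isDomain
      (Algebra.TensorProduct.map (AlgHom.id K (AlgebraicClosure K)) i).toRingHom
      (Module.Flat.lTensor_preserves_injective_linearMap i.toLinearMap hi)
  -- It suffices to treat an algebraically closed extension, and this contains an algebraic
  -- closure of `K`.
  let j : AlgebraicClosure K →ₐ[K] AlgebraicClosure K' := IsAlgClosed.lift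
  let := j.toRingHom.toAlgebra
  have : IsScalarTower K (AlgebraicClosure K) (AlgebraicClosure K') :=
    .of_algebraMap_eq fun x => (j.commutes x).symm
  have h2 := isDomain_tensorProduct_of_isAlgClosed (AlgebraicClosure K) (AlgebraicClosure K ⊗[K] A)
    (AlgebraicClosure K')
  let e' : (AlgebraicClosure K ⊗[K] A) ⊗[AlgebraicClosure K] AlgebraicClosure K' ≃+*
      AlgebraicClosure K' ⊗[K] A :=
    (Algebra.TensorProduct.comm (AlgebraicClosure K) (AlgebraicClosure K ⊗[K] A)
      (AlgebraicClosure K')).toRingEquiv.trans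
      (Algebra.TensorProduct.cancelBaseChange K (AlgebraicClosure K) (AlgebraicClosure K)
        (AlgebraicClosure K') A).toRingEquiv
  have h3 : IsDomain (AlgebraicClosure K' ⊗[K] A) := e'.symm.toMulEquiv.isDomain
  exact Function.Injective.isDomain
    (Algebra.TensorProduct.map (IsScalarTower.toAlgHom K K' (AlgebraicClosure K'))
      (AlgHom.id K A)).toRingHom
    (Module.Flat.rTensor_preserves_injective_linearMap
      (IsScalarTower.toAlgHom K K' (AlgebraicClosure K')).toLinearMap
      (algebraMap K' (AlgebraicClosure K')).injective)

/-! ### Homogeneous schemes are smooth -/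

/-- A reduced scheme locally of finite type over an algebraically closed field is smooth if its
automorphisms act transitively on its rational points: the smooth locus is stable under
automorphisms, and it contains a rational point because it is dense and open. -/
theorem smooth_of_homogeneous {k : Type u} [Field k] [IsAlgClosed k] {G : Scheme.{u}}
    (f : G ⟶ Spec (.of k)) [LocallyOfFiniteType f] [IsReduced G] [Nonempty G]
    (H : ∀ x y : Spec (.of k) ⟶ G, x ≫ f = 𝟙 _ → y ≫ f = 𝟙 _ →
      ∃ α : G ≅ G, α.hom ≫ f = f ∧ x ≫ α.hom = y) : Smooth f := by
  have := LocallyOfFiniteType.jacobsonSpace f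
  rw [← Scheme.Hom.smoothLocus_eq_top_iff, ← TopologicalSpace.Opens.coe_eq_univ,
    ← not_ne_iff, ← Set.nonempty_compl]
  intro hne
  obtain ⟨x, hx, hxc⟩ :=
    nonempty_inter_closedPoints hne f.smoothLocus.2.isClosed_compl.isLocallyClosed
  obtain ⟨y, hy : y ∈ f.smoothLocus, hyc⟩ := nonempty_inter_closedPoints
    f.dense_smoothLocus_of_perfectField.nonempty f.smoothLocus.2.isLocallyClosed
  obtain ⟨α, hαf, hα⟩ := H _ _ (pointOfClosedPoint_comp f x hxc) (pointOfClosedPoint_comp f y hyc)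
  have hα' : α.hom x = y := by
    rw [← pointOfClosedPoint_apply f y hyc (IsLocalRing.closedPoint k), ← hα]
    exact congrArg α.hom (pointOfClosedPoint_apply f x hxc _).symm
  rw [← hα'] at hy
  have hmem : x ∈ α.hom ⁻¹ᵁ f.smoothLocus := hy
  rw [Scheme.Hom.preimage_smoothLocus_eq] at hmem
  simp only [hαf] at hmem
  exact hx hmem

/-- The affine case of `smooth_of_homogeneous`. -/
theorem algebra_smooth_of_homogeneous (k A : Type u) [Field k] [IsAlgClosed k] [CommRing A]
    [IsReduced A] [Nontrivial A] [Algebra k A] [Algebra.FiniteType k A]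
    (H : ∀ x y : A →ₐ[k] k, ∃ α : A ≃ₐ[k] A, ∀ a, x (α a) = y a) : Algebra.Smooth k A := by
  have hft : LocallyOfFiniteType (Spec.map (CommRingCat.ofHom (algebraMap k A))) := by
    rw [HasRingHomProperty.Spec_iff (P := @LocallyOfFiniteType)]
    exact RingHom.finiteType_algebraMap.2 inferInstance
  have hred : IsReduced (CommRingCat.of A) := ‹IsReduced A›
  have hne : Nonempty (Spec (.of A)) := inferInstanceAs (Nonempty (PrimeSpectrum A))
  have : Smooth (Spec.map (CommRingCat.ofHom (algebraMap k A))) := by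
    refine smooth_of_homogeneous _ fun x y hx hy => ?_
    obtain ⟨x, rfl⟩ := Spec.map_surjective x
    obtain ⟨y, rfl⟩ := Spec.map_surjective y
    rw [← Spec.map_comp, ← Spec.map_id, Spec.map_inj] at hx hy
    let x' : A →ₐ[k] k := ⟨x.hom, fun r => congr($(hx).hom r)⟩
    let y' : A →ₐ[k] k := ⟨y.hom, fun r => congr($(hy).hom r)⟩
    obtain ⟨α, hα⟩ := H x' y'
    refine ⟨Scheme.Spec.mapIso (α.toRingEquiv.toCommRingCatIso).op, ?_, ?_⟩
    · change Spec.map _ ≫ Spec.map _ = _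
      rw [← Spec.map_comp, Spec.map_inj]
      ext r
      exact α.commutes r
    · change Spec.map _ ≫ Spec.map _ = _
      rw [← Spec.map_comp, Spec.map_inj]
      ext r
      exact hα r
  rw [HasRingHomProperty.Spec_iff (P := @Smooth)] at this
  exact RingHom.smooth_algebraMap.1 this

/-! ### Dimension of finitely generated algebras -/

/-- Incomparability gives one inequality, going up the other. -/
theorem ringKrullDim_eq_of_isIntegral (R S : Type*) [CommRing R] [CommRing S] [Algebra R S]
    [Algebra.IsIntegral R S] [FaithfulSMul R S] : ringKrullDim S = ringKrullDim R := by
  apply le_antisymm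
  · refine Order.krullDim_le_of_strictMono (PrimeSpectrum.comap (algebraMap R S)) ?_
    intro p q hpq
    exact Ideal.IsIntegral.comap_lt_comap hpq
  · refine iSup_le fun l => ?_
    obtain ⟨P, -, hP, hPl⟩ :=
      Ideal.exists_ideal_over_prime_of_isIntegral l.head.asIdeal (⊥ : Ideal S) (by
        rw [← RingHom.ker_eq_comap_bot, (RingHom.injective_iff_ker_eq_bot _).1
          (FaithfulSMul.algebraMap_injective R S)]
        exact bot_le)
    have : P.LiesOver l.head.asIdeal := ⟨hPl.symm⟩
    obtain ⟨L, hL, -⟩ := Ideal.exists_ltSeries_of_hasGoingUp l P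
    rw [← hL]
    exact Order.LTSeries.length_le_krullDim L

theorem ringKrullDim_eq_of_isIntegral_algHom {k A : Type*} [Field k] [CommRing A] [Algebra k A]
    {n : ℕ} (g : MvPolynomial (Fin n) k →ₐ[k] A) (hg : Function.Injective g)
    (hint : g.IsIntegral) :
    ringKrullDim A = n := by
  algebraize [g.toRingHom]
  have : FaithfulSMul (MvPolynomial (Fin n) k) A :=
    (faithfulSMul_iff_algebraMap_injective _ _).2 hg
  rw [ringKrullDim_eq_of_isIntegral (MvPolynomial (Fin n) k) A,
    MvPolynomial.ringKrullDim_of_isNoetherianRing, ringKrullDim_eq_zero_of_field]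
  simp

theorem isIntegral_tensorProduct_map {k A B k' : Type*} [CommRing k] [CommRing A] [CommRing B]
    [CommRing k'] [Algebra k A] [Algebra k B] [Algebra k k'] {g : A →ₐ[k] B} (hg : g.IsIntegral) :
    (Algebra.TensorProduct.map (AlgHom.id k' k') g).IsIntegral := by
  intro x
  induction x with
  | zero => exact RingHom.isIntegralElem_zero _
  | add x y hx hy => exact RingHom.IsIntegralElem.add _ hx hy
  | tmul c b =>
    rw [← mul_one c, ← one_mul b, ← Algebra.TensorProduct.tmul_mul_tmul]
    refine RingHom.IsIntegralElem.mul _ ?_ ?_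
    · have : c ⊗ₜ[k] (1 : B) = Algebra.TensorProduct.map (AlgHom.id k' k') g (c ⊗ₜ 1) := by simp
      rw [this]
      exact RingHom.isIntegralElem_map _
    · have := (hg b).map (Algebra.TensorProduct.includeRight : B →ₐ[k] k' ⊗[k] B).toRingHom
      refine RingHom.IsIntegralElem.of_comp
        (f := (Algebra.TensorProduct.includeRight : A →ₐ[k] k' ⊗[k] A).toRingHom) ?_
      have hcomp : (Algebra.TensorProduct.includeRight : B →ₐ[k] k' ⊗[k] B).toRingHom.comp
          g.toRingHom = (Algebra.TensorProduct.map (AlgHom.id k' k') g).toRingHom.comp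
          (Algebra.TensorProduct.includeRight : A →ₐ[k] k' ⊗[k] A).toRingHom :=
        RingHom.ext fun a => by simp
      exact hcomp ▸ this

/-- The dimension of a finitely generated algebra does not change under extension of the base field,
since a Noether normalisation remains one. -/
theorem ringKrullDim_tensorProduct (k A k' : Type*) [Field k] [CommRing A] [Nontrivial A]
    [Algebra k A] [Algebra.FiniteType k A] [Field k'] [Algebra k k'] :
    ringKrullDim (k' ⊗[k] A) = ringKrullDim A := by
  obtain ⟨n, g, hg, hint⟩ := exists_integral_inj_algHom_of_fg k A
  let e := (MvPolynomial.algebraTensorAlgEquiv (σ := Fin n) k k').symm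
  let f := Algebra.TensorProduct.map (AlgHom.id k' k') g
  have hf : Function.Injective f :=
    Module.Flat.lTensor_preserves_injective_linearMap g.toLinearMap hg
  rw [ringKrullDim_eq_of_isIntegral_algHom g hg hint]
  exact ringKrullDim_eq_of_isIntegral_algHom (f.comp e.toAlgHom) (hf.comp e.injective)
    (RingHom.IsIntegral.trans _ _ (RingHom.isIntegral_of_surjective _ e.surjective)
      (isIntegral_tensorProduct_map hint))

theorem ringKrullDim_eq_trdeg {k : Type v} {A : Type w} {E : Type w₂} [Field k] [CommRing A]
    [IsDomain A] [Algebra k A] [Algebra.FiniteType k A] [Field E] [Algebra k E] [Algebra A E]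
    [IsScalarTower k A E] [IsFractionRing A E] :
    ringKrullDim A = ((Cardinal.toENat (Algebra.trdeg k E) : ℕ∞) : WithBot ℕ∞) := by
  obtain ⟨n, g, hg, hint⟩ := exists_integral_inj_algHom_of_fg k A
  rw [ringKrullDim_eq_of_isIntegral_algHom g hg hint]
  algebraize [g.toRingHom]
  have h1 : FaithfulSMul (MvPolynomial (Fin n) k) A :=
    (faithfulSMul_iff_algebraMap_injective _ _).2 hg
  have h2 : Algebra.trdeg k E = n := by
    have : Algebra.IsAlgebraic A E := IsLocalization.isAlgebraic E (nonZeroDivisors A)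
    let := ((algebraMap A E).comp g.toRingHom).toAlgebra
    have : IsScalarTower (MvPolynomial (Fin n) k) A E := .of_algebraMap_eq fun _ => rfl
    have : Algebra.IsAlgebraic (MvPolynomial (Fin n) k) E := .trans _ A _
    have : IsScalarTower k (MvPolynomial (Fin n) k) E := by
      refine .of_algebraMap_eq fun x => ?_
      rw [IsScalarTower.algebraMap_apply k A E, ← g.commutes]; rfl
    have : FaithfulSMul (MvPolynomial (Fin n) k) E :=
      (faithfulSMul_iff_algebraMap_injective _ _).2
        ((IsFractionRing.injective A E).comp hg)
    have := lift_trdeg_add_eq k (MvPolynomial (Fin n) k) E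
    have h0 : Algebra.trdeg (MvPolynomial (Fin n) k) E = 0 := trdeg_eq_zero
    have h3 : Cardinal.lift.{v} (Algebra.trdeg k E) = Cardinal.lift.{v} (n : Cardinal.{w₂}) := by
      simpa [h0] using this.symm
    exact Cardinal.lift_injective h3
  simp [h2]

/-! ### The torsor isomorphism -/

section evalGL

theorem generalLinearGroup_map_map {A B C : Type*} [CommRing A] [CommRing B] [CommRing C] {r : ℕ}
    (f : A →+* B) (g : B →+* C) (M : GL (Fin r) A) :
    Matrix.GeneralLinearGroup.map g (Matrix.GeneralLinearGroup.map f M) =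
      Matrix.GeneralLinearGroup.map (g.comp f) M :=
  rfl

variable {R S T : Type u} [CommRing R] [CommRing S] [CommRing T] [Algebra R S] [Algebra R T] {r : ℕ}

theorem evalGL_algebraMap (M : GL (Fin r) S) (p : MvPolynomial (Fin r × Fin r) R) :
    evalGL R M (algebraMap _ _ p) = MvPolynomial.aeval (fun q : Fin r × Fin r => M.val q.1 q.2) p :=
  IsLocalization.lift_eq _ _

theorem evalGL_map (f : S →ₐ[R] T) (M : GL (Fin r) S) :
    evalGL R (Matrix.GeneralLinearGroup.map f.toRingHom M) = f.comp (evalGL R M) := by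
  refine IsLocalization.algHom_ext
    (Submonoid.powers (Matrix.mvPolynomialX (Fin r) (Fin r) R).det) ?_
  refine MvPolynomial.algHom_ext fun q => ?_
  change evalGL R _ (algebraMap _ _ (MvPolynomial.X q)) =
    f (evalGL R M (algebraMap _ _ (MvPolynomial.X q)))
  simp [evalGL_algebraMap]

/-- The algebra generated by an invertible matrix and its inverse determinant lies in every
subalgebra over which the matrix is invertible. -/
theorem range_evalGL_map_le (U : Subalgebra R S) (N : GL (Fin r) U) :
    (evalGL R (Matrix.GeneralLinearGroup.map U.val.toRingHom N)).range ≤ U := by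
  rw [evalGL_map]
  rintro _ ⟨x, rfl⟩
  exact (evalGL R N x).2

/-- An `S`-valued point `M` of `GL_r` is defined over the subalgebra generated by its entries and
the inverse of its determinant. -/
theorem exists_map_range_evalGL (M : GL (Fin r) S) : ∃ N : GL (Fin r) (evalGL R M).range,
    Matrix.GeneralLinearGroup.map (evalGL R M).range.val.toRingHom N = M := by
  let X : Matrix (Fin r) (Fin r) (CoordRing R r) :=
    (Matrix.mvPolynomialX (Fin r) (Fin r) R).map (algebraMap _ _)
  have hX : IsUnit X.det := by
    change IsUnit (RingHom.mapMatrix (algebraMap _ _) (Matrix.mvPolynomialX (Fin r) (Fin r) R)).det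
    rw [← RingHom.map_det]
    exact IsLocalization.Away.algebraMap_isUnit _
  refine ⟨Matrix.GeneralLinearGroup.map (evalGL R M).rangeRestrict.toRingHom
    (Matrix.GeneralLinearGroup.mk'' X hX), ?_⟩
  ext i j
  change evalGL R M (algebraMap _ _ (Matrix.mvPolynomialX (Fin r) (Fin r) R i j)) = _
  simp [evalGL_algebraMap]

end evalGL

/-- Let `θ` be the comorphism of an isomorphism `(z, w) ↦ (z, z⁻¹ w)` that takes the diagonal to the
unit section, given by the counit `e`. Its fibre over a point `z` is an isomorphism `w ↦ z⁻¹ w` that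
takes `z` to the unit element; `φ` is the comorphism of this fibre. -/
theorem exists_baseChange_equiv {F K S D Ω : Type*} [CommRing F] [CommRing K] [CommRing S]
    [CommRing D] [CommRing Ω] [Algebra F K] [Algebra K S] [Algebra F S] [IsScalarTower F K S]
    [Algebra F D] [Algebra K Ω] [Algebra F Ω] [IsScalarTower F K Ω]
    (θ : S ⊗[F] D ≃ₐ[S] S ⊗[K] S) (e : D →ₐ[F] F)
    (hθ : ∀ d, Algebra.TensorProduct.lmul' K (θ (1 ⊗ₜ d)) = algebraMap F S (e d))
    (z : S →ₐ[K] Ω) :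
    ∃ φ : Ω ⊗[F] D ≃ₐ[Ω] Ω ⊗[K] S, ∀ x,
      Algebra.TensorProduct.lift (AlgHom.id Ω Ω) z (fun _ _ => .all _ _) (φ x) =
        Algebra.TensorProduct.lift (AlgHom.id Ω Ω) ((Algebra.ofId F Ω).comp e)
          (fun _ _ => .all _ _) x := by
  let := z.toRingHom.toAlgebra
  have : IsScalarTower K S Ω := .of_algebraMap_eq fun x => (z.commutes x).symm
  have : IsScalarTower F S Ω := .of_algebraMap_eq fun x => by
    rw [IsScalarTower.algebraMap_apply F K Ω, IsScalarTower.algebraMap_apply F K S,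
      IsScalarTower.algebraMap_apply K S Ω]
  let φ : Ω ⊗[F] D ≃ₐ[Ω] Ω ⊗[K] S :=
    (Algebra.TensorProduct.cancelBaseChange F S Ω Ω D).symm.trans
      ((Algebra.TensorProduct.congr (AlgEquiv.refl (R := Ω) (A₁ := Ω)) θ).trans
        (Algebra.TensorProduct.cancelBaseChange K S Ω Ω S))
  have hz : ∀ y : S ⊗[K] S,
      Algebra.TensorProduct.lift (AlgHom.id Ω Ω) z (fun _ _ => .all _ _)
        (Algebra.TensorProduct.cancelBaseChange K S Ω Ω S (1 ⊗ₜ y)) =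
        z (Algebra.TensorProduct.lmul' K y) := by
    intro y
    induction y with
    | zero => simp
    | add x y hx hy => rw [TensorProduct.tmul_add, map_add, map_add, hx, hy, map_add, map_add]
    | tmul a b =>
      simp only [Algebra.TensorProduct.cancelBaseChange_tmul, Algebra.TensorProduct.lift_tmul,
        AlgHom.id_apply, Algebra.TensorProduct.lmul'_apply_tmul, map_mul, Algebra.smul_def, mul_one]
      rfl
  refine ⟨φ, fun x => ?_⟩
  suffices h : (Algebra.TensorProduct.lift (AlgHom.id Ω Ω) z (fun _ _ => .all _ _)).comp
      φ.toAlgHom = Algebra.TensorProduct.lift (AlgHom.id Ω Ω) ((Algebra.ofId F Ω).comp e)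
          (fun _ _ => .all _ _) from DFunLike.congr_fun h x
  refine Algebra.TensorProduct.ext (Subsingleton.elim _ _) (AlgHom.ext fun d => ?_)
  have h1 : φ (1 ⊗ₜ d) =
      Algebra.TensorProduct.cancelBaseChange K S Ω Ω S (1 ⊗ₜ (θ (1 ⊗ₜ d))) := by
    simp [φ]
  change Algebra.TensorProduct.lift (AlgHom.id Ω Ω) z (fun _ _ => .all _ _) (φ (1 ⊗ₜ d)) =
    Algebra.TensorProduct.lift (AlgHom.id Ω Ω) ((Algebra.ofId F Ω).comp e)
      (fun _ _ => .all _ _) (1 ⊗ₜ d)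
  rw [h1, hz, hθ]
  simp [Algebra.ofId_apply, IsScalarTower.algebraMap_apply F K S,
    IsScalarTower.algebraMap_apply F K Ω]

section torsor

variable {F K L : Type u} [Field F] [Field K] [Field L]
    [Algebra F K] [Algebra K L] [Algebra F L] [IsScalarTower F K L]
    {σ : L ≃+* L} {r : ℕ} {Φ : GL (Fin r) K} {Ψ : GL (Fin r) L}

/-- The automorphism `σ` of `L` acts diagonally on `L ⊗[K] L`, although it is not `K`-linear. -/
theorem exists_tensor_map (hadm : IsAdmissible F K L σ) :
    ∃ τ : L ⊗[K] L →ₐ[F] L ⊗[K] L, ∀ a b, τ (a ⊗ₜ b) = σ a ⊗ₜ σ b := by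
  have hK : ∀ c : K, ∃ c' : K, algebraMap K L c' = σ (algebraMap K L c) := by
    intro c
    have : σ (algebraMap K L c) ∈ (algebraMap K L).fieldRange :=
      hadm.restricts_K ▸ ⟨_, ⟨c, rfl⟩, rfl⟩
    exact this
  let t : L ⊗[K] L →+ L ⊗[K] L := TensorProduct.liftAddHom
    { toFun := fun a => ((TensorProduct.mk K L L (σ a)).toAddMonoidHom).comp
        (σ : L →+* L).toAddMonoidHom
      map_zero' := by ext; simp
      map_add' := fun a b => by ext; simp }
    (fun c a b => by
      obtain ⟨c', hc'⟩ := hK c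
      simp only [Algebra.smul_def, AddMonoidHom.coe_mk, ZeroHom.coe_mk, AddMonoidHom.comp_apply]
      change σ (algebraMap K L c * a) ⊗ₜ[K] σ b = σ a ⊗ₜ[K] σ (algebraMap K L c * b)
      rw [map_mul, map_mul, ← hc', ← Algebra.smul_def, ← Algebra.smul_def, TensorProduct.smul_tmul])
  have ht : ∀ a b, t (a ⊗ₜ b) = σ a ⊗ₜ σ b := fun a b => rfl
  have hmul : ∀ x y, t (x * y) = t x * t y := by
    intro x y
    induction x with
    | zero => simp
    | add x x' hx hx' => rw [add_mul, map_add, hx, hx', map_add, add_mul]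
    | tmul a b =>
      induction y with
      | zero => simp
      | add x x' hx hx' => rw [mul_add, map_add, hx, hx', map_add, mul_add]
      | tmul c d => simp [ht]
  refine ⟨{ t with
    map_one' := by
      change t (1 ⊗ₜ 1) = _
      rw [ht, map_one]; rfl
    map_mul' := hmul
    commutes' := fun f => ?_ }, ht⟩
  change t (algebraMap F L f ⊗ₜ 1) = algebraMap F L f ⊗ₜ 1
  rw [ht, map_one, (hadm.fixed _).2 ⟨f, rfl⟩]

/-- The matrix `Ψ₁⁻¹ Ψ₂` is invariant under `σ ⊗ σ`, as `Ψ₁` and `Ψ₂` are both multiplied by `Φ`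
from the left. -/
theorem apply_eq_self_of_mem_groupAlgebra {τ : L ⊗[K] L →ₐ[F] L ⊗[K] L}
    (hτ : ∀ a b, τ (a ⊗ₜ b) = σ a ⊗ₜ σ b)
    (hΨ : Matrix.GeneralLinearGroup.map (σ : L →+* L) Ψ =
      Matrix.GeneralLinearGroup.map (algebraMap K L) Φ * Ψ)
    {d : L ⊗[K] L} (hd : d ∈ groupAlgebra F K Ψ) : τ d = d := by
  let l : L →+* L ⊗[K] L := (Algebra.TensorProduct.includeLeft : L →ₐ[K] L ⊗[K] L).toRingHom
  let ρ : L →+* L ⊗[K] L := (Algebra.TensorProduct.includeRight : L →ₐ[K] L ⊗[K] L).toRingHom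
  have hl : τ.toRingHom.comp l = l.comp (σ : L →+* L) := by
    ext a; change τ (a ⊗ₜ 1) = _; rw [hτ, map_one]; rfl
  have hρ : τ.toRingHom.comp ρ = ρ.comp (σ : L →+* L) := by
    ext a; change τ (1 ⊗ₜ a) = _; rw [hτ, map_one]; rfl
  have hlρ : l.comp (algebraMap K L) = ρ.comp (algebraMap K L) := by
    ext a; exact Algebra.TensorProduct.tmul_one_eq_one_tmul a
  have h : Matrix.GeneralLinearGroup.map τ.toRingHom (psiTilde K Ψ) = psiTilde K Ψ := by
    change Matrix.GeneralLinearGroup.map τ.toRingHom ((Matrix.GeneralLinearGroup.map l Ψ)⁻¹ *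
      Matrix.GeneralLinearGroup.map ρ Ψ) = (Matrix.GeneralLinearGroup.map l Ψ)⁻¹ *
      Matrix.GeneralLinearGroup.map ρ Ψ
    rw [map_mul, map_inv, generalLinearGroup_map_map, generalLinearGroup_map_map, hl, hρ,
      ← generalLinearGroup_map_map, ← generalLinearGroup_map_map, hΨ, map_mul, map_mul,
      generalLinearGroup_map_map, generalLinearGroup_map_map, hlρ]
    group
  obtain ⟨x, rfl⟩ := hd
  change (τ.comp (evalGL F (psiTilde K Ψ))) x = _
  rw [← evalGL_map, h]
  rfl

/-- The counit of the algebra of the group: multiplication `L ⊗[K] L → L` commutes with `σ`, so it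
maps the invariant elements into `L^σ = F`. -/
theorem exists_counit (hadm : IsAdmissible F K L σ)
    (hΨ : Matrix.GeneralLinearGroup.map (σ : L →+* L) Ψ =
      Matrix.GeneralLinearGroup.map (algebraMap K L) Φ * Ψ) :
    ∃ e : groupAlgebra F K Ψ →ₐ[F] F, ∀ d : groupAlgebra F K Ψ,
      Algebra.TensorProduct.lmul' K (d : L ⊗[K] L) = algebraMap F L (e d) := by
  obtain ⟨τ, hτ⟩ := exists_tensor_map hadm
  let m : L ⊗[K] L →ₐ[F] L := (Algebra.TensorProduct.lmul' K).restrictScalars F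
  have hm : ∀ x, m (τ x) = σ (m x) := by
    intro x
    induction x with
    | zero => simp
    | add x y hx hy => simp only [map_add, hx, hy]
    | tmul a b => simp [m, hτ]
  have hmem : ∀ d : groupAlgebra F K Ψ, m d ∈ (⊥ : Subalgebra F L) := by
    intro d
    refine Algebra.mem_bot.2 ((hadm.fixed _).1 ?_)
    rw [← hm, apply_eq_self_of_mem_groupAlgebra hτ hΨ d.2]
  let e₀ := (m.comp (groupAlgebra F K Ψ).val).codRestrict ⊥ hmem
  let b := Algebra.botEquivOfInjective (algebraMap F L).injective
  refine ⟨b.toAlgHom.comp e₀, fun d => ?_⟩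
  have h : b.symm (b (e₀ d)) = e₀ d := b.symm_apply_apply _
  exact (congrArg Subtype.val h).symm

/-- The torsor property `Z × Γ ≅ Z × Z`. Both sides are identified with one subalgebra of
`L ⊗[K] L`: injectivity on the left is Artin's argument for `σ`, and the two images agree because
`Ψ₂ = Ψ₁ (Ψ₁⁻¹ Ψ₂)`. -/
theorem exists_torsor_equiv (hadm : IsAdmissible F K L σ)
    (hΨ : Matrix.GeneralLinearGroup.map (σ : L →+* L) Ψ =
      Matrix.GeneralLinearGroup.map (algebraMap K L) Φ * Ψ) :
    ∃ θ : solutionAlgebra K Ψ ⊗[F] groupAlgebra F K Ψ ≃ₐ[solutionAlgebra K Ψ]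
        solutionAlgebra K Ψ ⊗[K] solutionAlgebra K Ψ,
      ∀ d : groupAlgebra F K Ψ,
        Algebra.TensorProduct.map (solutionAlgebra K Ψ).val (solutionAlgebra K Ψ).val
          (θ (1 ⊗ₜ d)) = (d : L ⊗[K] L) := by
  obtain ⟨τ, hτ⟩ := exists_tensor_map hadm
  set S := solutionAlgebra K Ψ with hS
  set D := groupAlgebra F K Ψ with hD
  let p : S ⊗[F] D →ₐ[S] L ⊗[K] L :=
    Algebra.TensorProduct.lift (Algebra.ofId S (L ⊗[K] L)) D.val (fun _ _ => .all _ _)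
  let q : S ⊗[K] S →ₐ[S] L ⊗[K] L := Algebra.TensorProduct.map (Algebra.ofId S L) S.val
  have hp : Function.Injective p := by
    have h1 := liftBaseChange_injective_of_forall_fixed (F := F) (E := L) (V := L ⊗[K] L)
      (ι := Unit) (fun _ => (σ : L →+* L)) (fun _ => τ.toRingHom.toAddMonoidHom)
      (by
        intro _ a x
        change τ (a • x) = σ a • τ x
        rw [Algebra.smul_def, Algebra.smul_def, map_mul]
        congr 1
        change τ (a ⊗ₜ 1) = σ a ⊗ₜ 1
        rw [hτ, map_one])
      (fun a ha => (hadm.fixed a).1 (ha ()))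
      D.val.toLinearMap Subtype.val_injective
      (fun _ d => apply_eq_self_of_mem_groupAlgebra hτ hΨ d.2)
    have h2 : Function.Injective
        (LinearMap.rTensor D (IsScalarTower.toAlgHom F S L).toLinearMap) :=
      Module.Flat.rTensor_preserves_injective_linearMap _ Subtype.val_injective
    convert h1.comp h2 using 1
    ext x
    induction x with
    | zero => simp
    | add x y hx hy => rw [map_add, hx, hy]; simp
    | tmul a d =>
      change Algebra.TensorProduct.lift _ _ _ (a ⊗ₜ d) = (a : L) • (d : L ⊗[K] L)
      rw [Algebra.TensorProduct.lift_tmul, Algebra.smul_def]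
      rfl
  have hq : Function.Injective q := by
    change Function.Injective (Algebra.TensorProduct.map S.val S.val)
    exact TensorProduct.map_injective_of_flat_flat _ _ Subtype.val_injective Subtype.val_injective
  obtain ⟨N, hN⟩ := exists_map_range_evalGL (R := K) Ψ
  obtain ⟨N', hN'⟩ := exists_map_range_evalGL (R := F) (psiTilde K Ψ)
  let l : L →+* L ⊗[K] L := (Algebra.TensorProduct.includeLeft : L →ₐ[K] L ⊗[K] L).toRingHom
  let ρ : L →ₐ[K] L ⊗[K] L := Algebra.TensorProduct.includeRight
  have hpq : p.range = q.range := by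
    apply le_antisymm
    · have hD : D ≤ q.range.restrictScalars F := by
        let l₀ : S →+* q.range.restrictScalars F := q.rangeRestrict.toRingHom.comp
          (Algebra.TensorProduct.includeLeft : S →ₐ[K] S ⊗[K] S).toRingHom
        let ρ₀ : S →+* q.range.restrictScalars F := q.rangeRestrict.toRingHom.comp
          (Algebra.TensorProduct.includeRight : S →ₐ[K] S ⊗[K] S).toRingHom
        have h := range_evalGL_map_le (q.range.restrictScalars F)
          ((Matrix.GeneralLinearGroup.map l₀ N)⁻¹ * Matrix.GeneralLinearGroup.map ρ₀ N)
        have hl₀ : (q.range.restrictScalars F).val.toRingHom.comp l₀ = l.comp S.val.toRingHom := by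
          ext a
          change q (a ⊗ₜ 1) = (a : L) ⊗ₜ 1
          rfl
        have hρ₀ : (q.range.restrictScalars F).val.toRingHom.comp ρ₀ =
            ρ.toRingHom.comp S.val.toRingHom := by
          ext a
          change ((1 : S) : L) ⊗ₜ[K] (a : L) = 1 ⊗ₜ (a : L)
          rfl
        rwa [map_mul, map_inv, generalLinearGroup_map_map, generalLinearGroup_map_map, hl₀, hρ₀,
          ← generalLinearGroup_map_map, ← generalLinearGroup_map_map, hN] at h
      rintro _ ⟨x, rfl⟩
      change p x ∈ q.range
      induction x with
      | zero => simp
      | add x y hx hy => rw [map_add]; exact add_mem hx hy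
      | tmul a d =>
        have : p (a ⊗ₜ d) = algebraMap S _ a * (d : L ⊗[K] L) :=
          Algebra.TensorProduct.lift_tmul ..
        rw [this]
        exact mul_mem (algebraMap_mem _ _) (hD d.2)
    · have hS : ∀ s : S, (1 : L) ⊗ₜ[K] (s : L) ∈ p.range := by
        let l₀ : S →+* p.range.restrictScalars K := p.rangeRestrict.toRingHom.comp
          (algebraMap S (S ⊗[F] D))
        let δ : D →+* p.range.restrictScalars K := p.rangeRestrict.toRingHom.comp
          (Algebra.TensorProduct.includeRight : D →ₐ[F] S ⊗[F] D).toRingHom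
        have h := range_evalGL_map_le (p.range.restrictScalars K)
          (Matrix.GeneralLinearGroup.map l₀ N * Matrix.GeneralLinearGroup.map δ N')
        have hl₀ : (p.range.restrictScalars K).val.toRingHom.comp l₀ = l.comp S.val.toRingHom := by
          ext a
          exact p.commutes a
        have hδ : (p.range.restrictScalars K).val.toRingHom.comp δ = D.val.toRingHom := by
          ext a
          change p (1 ⊗ₜ a) = a
          simp [p]
        rw [map_mul, generalLinearGroup_map_map, generalLinearGroup_map_map, hl₀, hδ,
          ← generalLinearGroup_map_map, hN, hN'] at h
        have hΨ₂ : Matrix.GeneralLinearGroup.map l Ψ * psiTilde K Ψ =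
            Matrix.GeneralLinearGroup.map ρ.toRingHom Ψ := mul_inv_cancel_left _ _
        rw [hΨ₂, evalGL_map] at h
        rintro ⟨_, x, rfl⟩
        exact h ⟨x, rfl⟩
      rintro _ ⟨x, rfl⟩
      change q x ∈ p.range
      induction x with
      | zero => simp
      | add x y hx hy => rw [map_add]; exact add_mem hx hy
      | tmul a s =>
        have : q (a ⊗ₜ s) = algebraMap S _ a * (1 : L) ⊗ₜ[K] (s : L) := by
          change (a : L) ⊗ₜ[K] (s : L) = ((a : L) ⊗ₜ[K] (1 : L)) * _
          simp
        rw [this]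
        exact mul_mem (algebraMap_mem _ _) (hS s)
  let eq : S ⊗[K] S ≃ₐ[S] q.range := AlgEquiv.ofInjective q hq
  refine ⟨(AlgEquiv.ofInjective p hp).trans ((Subalgebra.equivOfEq _ _ hpq).trans eq.symm),
    fun d => ?_⟩
  have h1 : q (eq.symm (Subalgebra.equivOfEq _ _ hpq (AlgEquiv.ofInjective p hp (1 ⊗ₜ d)))) =
      p (1 ⊗ₜ d) := congrArg Subtype.val (eq.apply_symm_apply _)
  have h2 : p (1 ⊗ₜ d) = d := by simp [p]
  exact h1.trans h2

end torsor

/-! ### Geometric properties of the torsor and its group -/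

theorem geometricallyIrreducible_Spec {k A : Type u} [Field k] [CommRing A] [Algebra k A]
    (h : ∀ (k' : Type u) [Field k'] [Algebra k k'], IsDomain (k' ⊗[k] A)) :
    GeometricallyIrreducible (Spec.map (CommRingCat.ofHom (algebraMap k A))) := by
  refine ⟨geometrically_iff_of_commRing_of_isClosedUnderIsomorphisms.2 fun k' _ _ => ?_⟩
  have := h k'
  have : IsDomain (A ⊗[k] k') := (Algebra.TensorProduct.comm k A k').toMulEquiv.isDomain
  rw [(pullbackSpecIso k A k').hom.homeomorph.irreducibleSpace_iff]
  exact inferInstanceAs (IrreducibleSpace (PrimeSpectrum (A ⊗[k] k')))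

theorem smooth_Spec {k A : Type u} [Field k] [CommRing A] [Algebra k A] [Algebra.Smooth k A] :
    Smooth (Spec.map (CommRingCat.ofHom (algebraMap k A))) := by
  rw [HasRingHomProperty.Spec_iff (P := @Smooth)]
  exact RingHom.smooth_algebraMap.2 inferInstance

/-- Any two extensions of a field embed into a common one, a residue field of their tensor
product. -/
theorem exists_common_field_extension (F A B : Type u) [Field F] [Field A] [Field B] [Algebra F A]
    [Algebra F B] : ∃ (Ω : Type u) (_ : Field Ω) (_ : Algebra F Ω),
      Nonempty (A →ₐ[F] Ω) ∧ Nonempty (B →ₐ[F] Ω) := by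
  obtain ⟨m, hm⟩ := Ideal.exists_maximal (A ⊗[F] B)
  let := Ideal.Quotient.field m
  exact ⟨A ⊗[F] B ⧸ m, this, inferInstance,
    ⟨(Ideal.Quotient.mkₐ F m).comp Algebra.TensorProduct.includeLeft⟩,
    ⟨(Ideal.Quotient.mkₐ F m).comp Algebra.TensorProduct.includeRight⟩⟩

theorem finiteType_range_evalGL {R S : Type u} [CommRing R] [CommRing S] [Algebra R S] {r : ℕ}
    (M : GL (Fin r) S) : Algebra.FiniteType R (evalGL R M).range := by
  have : Algebra.FinitePresentation (MvPolynomial (Fin r × Fin r) R) (CoordRing R r) :=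
    IsLocalization.Away.finitePresentation (Matrix.mvPolynomialX (Fin r) (Fin r) R).det
  have : Algebra.FiniteType R (CoordRing R r) :=
    .trans (S := MvPolynomial (Fin r × Fin r) R) inferInstance inferInstance
  exact .of_surjective (evalGL R M).rangeRestrict (evalGL R M).rangeRestrict_surjective

section

variable {F K L : Type u} [Field F] [Field K] [Field L]
    [Algebra F K] [Algebra K L] [Algebra F L] [IsScalarTower F K L]
    {σ : L ≃+* L} {r : ℕ} {Φ : GL (Fin r) K} {Ψ : GL (Fin r) L}

/-- Over every base `Ω` over which `Z` has a point `z`, the map `w ↦ z⁻¹ w` is an isomorphism from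
`Z` to `Γ` that takes `z` to the unit element; `φ` is its comorphism, and `e` is the counit. -/
theorem exists_baseChange_groupAlgebra_equiv (hadm : IsAdmissible F K L σ)
    (hΨ : Matrix.GeneralLinearGroup.map (σ : L →+* L) Ψ =
      Matrix.GeneralLinearGroup.map (algebraMap K L) Φ * Ψ) :
    ∃ e : groupAlgebra F K Ψ →ₐ[F] F, ∀ (Ω : Type u) [CommRing Ω] [Algebra K Ω] [Algebra F Ω]
      [IsScalarTower F K Ω] (z : solutionAlgebra K Ψ →ₐ[K] Ω),
      ∃ φ : Ω ⊗[F] groupAlgebra F K Ψ ≃ₐ[Ω] Ω ⊗[K] solutionAlgebra K Ψ, ∀ x,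
        Algebra.TensorProduct.lift (AlgHom.id Ω Ω) z (fun _ _ => .all _ _) (φ x) =
          Algebra.TensorProduct.lift (AlgHom.id Ω Ω) ((Algebra.ofId F Ω).comp e)
            (fun _ _ => .all _ _) x := by
  obtain ⟨e, he⟩ := exists_counit hadm hΨ
  obtain ⟨θ, hθ⟩ := exists_torsor_equiv hadm hΨ
  refine ⟨e, fun Ω _ _ _ _ z => exists_baseChange_equiv θ e (fun d => Subtype.ext ?_) z⟩
  change _ = algebraMap F L (e d)
  rw [← he, ← hθ d]
  generalize θ (1 ⊗ₜ d) = y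
  induction y with
  | zero => simp
  | add x y hx hy => simp only [map_add, ← hx, ← hy]; rfl
  | tmul a b => simp

/-- `Z` is geometrically integral, since `Λ`, a subfield of `L`, is a regular extension of `K`. -/
theorem isDomain_tensorProduct_solutionAlgebra (hadm : IsAdmissible F K L σ)
    (hclosed : algebraicClosure K (solutionField K Ψ) = ⊥)
    (K' : Type u) [Field K'] [Algebra K K'] : IsDomain (K' ⊗[K] solutionAlgebra K Ψ) := by
  have := finiteType_range_evalGL (R := K) Ψ
  have := hadm.separable
  have : Algebra.IsGeometricallyReduced K (solutionField K Ψ) :=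
    .of_injective (IsFractionRing.liftAlgHom (K := solutionField K Ψ)
      (g := (solutionAlgebra K Ψ).val) Subtype.val_injective) (RingHom.injective _)
  exact isDomain_tensorProduct_of_algHom hclosed
    (IsScalarTower.toAlgHom K (solutionAlgebra K Ψ) (solutionField K Ψ))
    (IsFractionRing.injective _ _) K'

/-- `Γ` is geometrically integral: over an extension of `F` containing both `F'` and `L` it is
isomorphic to `Z` through the point `Ψ`. -/
theorem isDomain_tensorProduct_groupAlgebra (hadm : IsAdmissible F K L σ)
    (hΨ : Matrix.GeneralLinearGroup.map (σ : L →+* L) Ψ =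
      Matrix.GeneralLinearGroup.map (algebraMap K L) Φ * Ψ)
    (hclosed : algebraicClosure K (solutionField K Ψ) = ⊥)
    (F' : Type u) [Field F'] [Algebra F F'] : IsDomain (F' ⊗[F] groupAlgebra F K Ψ) := by
  obtain ⟨Ω, _, _, ⟨i⟩, ⟨j⟩⟩ := exists_common_field_extension F F' L
  let := (j.toRingHom.comp (algebraMap K L)).toAlgebra
  have : IsScalarTower F K Ω := .of_algebraMap_eq fun x => by
    rw [← j.commutes, IsScalarTower.algebraMap_apply F K L]; rfl
  let jK : L →ₐ[K] Ω := { j with commutes' := fun _ => rfl }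
  obtain ⟨e, h⟩ := exists_baseChange_groupAlgebra_equiv hadm hΨ
  obtain ⟨φ, -⟩ := h Ω (jK.comp (solutionAlgebra K Ψ).val)
  have := isDomain_tensorProduct_solutionAlgebra hadm hclosed Ω
  have : IsDomain (Ω ⊗[F] groupAlgebra F K Ψ) := φ.toMulEquiv.isDomain
  exact Function.Injective.isDomain
    (Algebra.TensorProduct.map i (AlgHom.id F (groupAlgebra F K Ψ))).toRingHom
    (Module.Flat.rTensor_preserves_injective_linearMap i.toLinearMap i.injective)

/-- For points `x` and `y` of `Z` over the algebraic closure, composing `w ↦ x⁻¹ w` with the inverse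
of `w ↦ y⁻¹ w` gives an automorphism of `Z` that takes `x` to `y`. So `Z` is homogeneous. -/
theorem smooth_algebraicClosure_tensorProduct_solutionAlgebra (hadm : IsAdmissible F K L σ)
    (hΨ : Matrix.GeneralLinearGroup.map (σ : L →+* L) Ψ =
      Matrix.GeneralLinearGroup.map (algebraMap K L) Φ * Ψ)
    (hclosed : algebraicClosure K (solutionField K Ψ) = ⊥) :
    Algebra.Smooth (AlgebraicClosure K) (AlgebraicClosure K ⊗[K] solutionAlgebra K Ψ) := by
  have := finiteType_range_evalGL (R := K) Ψ
  have := isDomain_tensorProduct_solutionAlgebra hadm hclosed (AlgebraicClosure K)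
  obtain ⟨e, h⟩ := exists_baseChange_groupAlgebra_equiv hadm hΨ
  let z (x : AlgebraicClosure K ⊗[K] solutionAlgebra K Ψ →ₐ[AlgebraicClosure K]
      AlgebraicClosure K) : solutionAlgebra K Ψ →ₐ[K] AlgebraicClosure K :=
    (x.restrictScalars K).comp Algebra.TensorProduct.includeRight
  have hz (x) : Algebra.TensorProduct.lift (AlgHom.id _ _) (z x) (fun _ _ => .all _ _) = x :=
    Algebra.TensorProduct.ext (Subsingleton.elim _ _) (AlgHom.ext fun a => by simp [z])
  refine algebra_smooth_of_homogeneous _ _ fun x y => ?_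
  obtain ⟨φ, hφ⟩ := h (AlgebraicClosure K) (z x)
  obtain ⟨ψ, hψ⟩ := h (AlgebraicClosure K) (z y)
  rw [hz] at hφ hψ
  refine ⟨ψ.symm.trans φ, fun a => ?_⟩
  rw [AlgEquiv.trans_apply, hφ, ← hψ, AlgEquiv.apply_symm_apply]

theorem nonempty_baseChange_algebraicClosure_equiv (hadm : IsAdmissible F K L σ)
    (hΨ : Matrix.GeneralLinearGroup.map (σ : L →+* L) Ψ =
      Matrix.GeneralLinearGroup.map (algebraMap K L) Φ * Ψ)
    (hclosed : algebraicClosure K (solutionField K Ψ) = ⊥) :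
    Nonempty (AlgebraicClosure K ⊗[F] groupAlgebra F K Ψ ≃ₐ[AlgebraicClosure K]
      AlgebraicClosure K ⊗[K] solutionAlgebra K Ψ) := by
  have := finiteType_range_evalGL (R := K) Ψ
  have := isDomain_tensorProduct_solutionAlgebra hadm hclosed (AlgebraicClosure K)
  obtain ⟨x, -⟩ := exists_algHom_apply_ne_zero (k := AlgebraicClosure K)
    (one_ne_zero (α := AlgebraicClosure K ⊗[K] solutionAlgebra K Ψ))
  obtain ⟨e, h⟩ := exists_baseChange_groupAlgebra_equiv hadm hΨ
  obtain ⟨φ, -⟩ := h (AlgebraicClosure K)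
    ((x.restrictScalars K).comp Algebra.TensorProduct.includeRight)
  exact ⟨φ⟩

end

end SigmaSemilinear

theorem theorem4p3p1 {F K L : Type u} [Field F] [Field K] [Field L]
    [Algebra F K] [Algebra K L] [Algebra F L] [IsScalarTower F K L]
    (σ : L ≃+* L) (hadm : SigmaSemilinear.IsAdmissible F K L σ)
    {r : ℕ} (Φ : GL (Fin r) K) (Ψ : GL (Fin r) L)
    (hΨ : Matrix.GeneralLinearGroup.map (σ : L →+* L) Ψ =
      Matrix.GeneralLinearGroup.map (algebraMap K L) Φ * Ψ)
    (hclosed : algebraicClosure K (SigmaSemilinear.solutionField K Ψ) = ⊥) :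
    (GeometricallyIrreducible (SigmaSemilinear.Z.structureMap K Ψ) ∧
      Smooth (SigmaSemilinear.baseChangeClosure (SigmaSemilinear.Z.structureMap K Ψ))) ∧
    (GeometricallyIrreducible (SigmaSemilinear.Γ.structureMap F K Ψ) ∧
      Smooth (SigmaSemilinear.baseChangeClosure (SigmaSemilinear.Γ.structureMap F K Ψ))) ∧
    topologicalKrullDim (SigmaSemilinear.Γ F K Ψ) =
      ((Cardinal.toENat (Algebra.trdeg K (SigmaSemilinear.solutionField K Ψ)) : ℕ∞) :
        WithBot ℕ∞) := by
  have := SigmaSemilinear.finiteType_range_evalGL (R := K) Ψ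
  have := SigmaSemilinear.finiteType_range_evalGL (R := F) (SigmaSemilinear.psiTilde K Ψ)
  obtain ⟨φ⟩ := SigmaSemilinear.nonempty_baseChange_algebraicClosure_equiv hadm hΨ hclosed
  have hs := SigmaSemilinear.smooth_algebraicClosure_tensorProduct_solutionAlgebra hadm hΨ hclosed
  have : Algebra.Smooth (AlgebraicClosure K)
      (AlgebraicClosure K ⊗[F] SigmaSemilinear.groupAlgebra F K Ψ) := .of_equiv φ.symm
  have : Algebra.Smooth K (SigmaSemilinear.solutionAlgebra K Ψ) :=
    .of_smooth_tensorProduct_of_faithfullyFlat (AlgebraicClosure K)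
  have : Algebra.Smooth F (SigmaSemilinear.groupAlgebra F K Ψ) :=
    .of_smooth_tensorProduct_of_faithfullyFlat (AlgebraicClosure K)
  have : Smooth (SigmaSemilinear.Z.structureMap K Ψ) := SigmaSemilinear.smooth_Spec
  have : Smooth (SigmaSemilinear.Γ.structureMap F K Ψ) := SigmaSemilinear.smooth_Spec
  refine ⟨⟨SigmaSemilinear.geometricallyIrreducible_Spec fun k' _ _ =>
    SigmaSemilinear.isDomain_tensorProduct_solutionAlgebra hadm hclosed k', inferInstance⟩,
    ⟨SigmaSemilinear.geometricallyIrreducible_Spec fun k' _ _ =>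
    SigmaSemilinear.isDomain_tensorProduct_groupAlgebra hadm hΨ hclosed k', inferInstance⟩, ?_⟩
  calc topologicalKrullDim (SigmaSemilinear.Γ F K Ψ)
      = ringKrullDim (SigmaSemilinear.groupAlgebra F K Ψ) :=
        PrimeSpectrum.topologicalKrullDim_eq_ringKrullDim _
    _ = ringKrullDim (AlgebraicClosure K ⊗[F] SigmaSemilinear.groupAlgebra F K Ψ) :=
        (SigmaSemilinear.ringKrullDim_tensorProduct F _ (AlgebraicClosure K)).symm
    _ = ringKrullDim (AlgebraicClosure K ⊗[K] SigmaSemilinear.solutionAlgebra K Ψ) :=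
        ringKrullDim_eq_of_ringEquiv φ.toRingEquiv
    _ = ringKrullDim (SigmaSemilinear.solutionAlgebra K Ψ) :=
        SigmaSemilinear.ringKrullDim_tensorProduct K _ (AlgebraicClosure K)
    _ = _ := SigmaSemilinear.ringKrullDim_eq_trdeg
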